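/- Let $G$ be a complete $K$-partite graph, $K\ge 1$, on a finite vertex set $V$ with nonempty components $V_1,\dots,V_K$ (two nodes are adjacent if and only if they belong to different components), and let $M=\max_k|V_k|$. Let $\Omega$ be the set of independent sets of $G$ (the feasible sets of active nodes). Packets arrive at each node $i\in V_k$ as a Poisson process of rate $\hat\rho_k>0$; transmission times are exponential with mean $1$; a node $i$ that is inactive and has no active neighbour activates at fixed rate $\nu_i>0$; an active node de-activates whenever a transmission is completed, i.e. at rate $1$, and then a packet leaves its queue if the queue is nonempty (nodes may be active with an empty queue). Put $\rho=\sum_{k=1}^K\hat\rho_k$ and $\rho_{\min}=\min_k\hat\rho_k$. Let $U(t)\in\Omega$ be the set of active nodes and $X(t)\in\mathbb N_0^V$ the vector of queue lengths. Let $\pi(u)\propto\prod_{i\in u}\nu_i$, $u\in\Omega$, be the stationary distribution of the Markov process $U(t)$, let $d(t)=\max_{U(0)\in\Omega}\frac12\sum_{u\in\Omega}|\mathbb P(U(t)=u)-\pi(u)|$, and let $t_{\rm mix}(\epsilon)=\inf\{t\ge 0: d(t)\le\epsilon\}$ (with $\inf\emptyset=\infty$). For all activation rates $(\nu_i)_{i\in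 V}$ for which the system is stable, i.e. for which the Markov process $(U(t),X(t))$ is positive recurrent, one has $\rho<1$ and, for every real $\epsilon$, $$t_{\rm mix}(\epsilon) > \bigl((K-1)\rho_{\min}-2\epsilon\bigr)\,\frac{(\rho_{\min})^M}{M}\left(\frac{1}{1-\rho}\right)^{M-1}.$$ Hence the mixing time grows at least like $(1-\rho)^{-(M-1)}$: for all $\delta>0$ and all $\epsilon<(K-1)\delta/2$ there is a constant $c>0$, depending only on $G$, $\delta$ and $\epsilon$, such that $t_{\rm mix}(\epsilon)>c\,(1-\rho)^{-(M-1)}$ for all loads with $\rho_{\min}\ge\delta$ and all activation rates for which the system is stable. -/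

import Mathlib

open scoped ENNReal

noncomputable section

/-! ### Positive recurrence of continuous-time Markov chains

A chain on a countable set `S` is given by its transition rates `q x y`, with `q x x = 0`. -/

namespace RateChain

variable {S : Type*}

/-- Total rate at which the chain leaves `x`; the holding time in `x` has mean `(exitRate q x)⁻¹`. -/
def exitRate (q : S → S → ℝ≥0∞) (x : S) : ℝ≥0∞ := ∑' y, q x y

/-- Transition probabilities of the embedded jump chain. -/
def jumpProb (q : S → S → ℝ≥0∞) (x y : S) : ℝ≥0∞ := q x y / exitRate q x

open scoped Classical in
/-- `taboo q z n y` is the probability that the jump chain started in `z` is in `y` after `n`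
jumps, without having returned to `z` at any of the jumps `1, …, n`. -/
def taboo (q : S → S → ℝ≥0∞) (z : S) : ℕ → S → ℝ≥0∞
  | 0, y => if y = z then 1 else 0
  | n + 1, y => if y = z then 0 else ∑' x, taboo q z n x * jumpProb q x y

/-- The probability that the chain started in `z` ever returns to `z`
(the `n`-th term is the probability that the first return happens at jump `n + 1`). -/
def returnProb (q : S → S → ℝ≥0∞) (z : S) : ℝ≥0∞ :=
  ∑' n, ∑' x, taboo q z n x * jumpProb q x z

/-- The expected time until the first return to `z`, for the chain started in `z`: the sum of the
mean holding times in all the states visited before the return. -/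
def meanReturnTime (q : S → S → ℝ≥0∞) (z : S) : ℝ≥0∞ :=
  ∑' n, ∑' y, taboo q z n y * (exitRate q y)⁻¹

/-- The chain is positive recurrent: from every state it returns to that state with
probability one, and after a time with finite expectation. -/
def PositiveRecurrent (q : S → S → ℝ≥0∞) : Prop :=
  ∀ z, returnProb q z = 1 ∧ meanReturnTime q z < ∞

end RateChain

/-! ### The random-access network

`G` is the interference graph.  All nodes have exponential transmission times with mean `1`,
node `i` has Poisson arrivals of rate `lam i` and exponential back-off times of mean `1 / nu i`
(a node starts a back-off after each transmission, and a transmission after each back-off). -/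

namespace RandomAccess

variable {V : Type*} [Fintype V] [DecidableEq V]

/-- The feasible joint activity states: the sets of active nodes which are independent in `G`. -/
def ActState (G : SimpleGraph V) : Type _ := {U : Finset V // G.IsIndepSet (U : Set V)}

instance (G : SimpleGraph V) : DecidableEq (ActState G) :=
  inferInstanceAs (DecidableEq {U : Finset V // G.IsIndepSet (U : Set V)})

instance (G : SimpleGraph V) : Finite (ActState G) :=
  inferInstanceAs (Finite {U : Finset V // G.IsIndepSet (U : Set V)})

instance (G : SimpleGraph V) : Fintype (ActState G) := Fintype.ofFinite _

/-- Transition rates of the process `(U(t), X(t))` of the set of active nodes and the queue lengths: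
arrivals, activations of unblocked nodes (the new set of active nodes has to be independent), and
transmission completions, which remove a packet if there is one (the subtraction of natural
numbers is truncated: `0 - 1 = 0`). -/
def networkRate (G : SimpleGraph V) (lam nu : V → ℝ)
    (s s' : ActState G × (V → ℕ)) : ℝ≥0∞ :=
  ∑ i, ((if s'.1 = s.1 ∧ s'.2 = s.2 + Pi.single i 1 then ENNReal.ofReal (lam i) else 0)
      + (if i ∉ s.1.1 ∧ s'.1.1 = insert i s.1.1 ∧ s'.2 = s.2 then ENNReal.ofReal (nu i) else 0)
      + (if i ∈ s.1.1 ∧ s'.1.1 = s.1.1.erase i ∧ s'.2 = s.2 - Pi.single i 1 then 1 else 0))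

/-- The system is stable: the process `(U(t), X(t))` is positive recurrent. -/
def Stable (G : SimpleGraph V) (lam nu : V → ℝ) : Prop :=
  RateChain.PositiveRecurrent (networkRate G lam nu)

/-- Transition rates of the activity process `U(t)`: activation of an unblocked node `i` at rate
`nu i`, de-activation of an active node at rate `1`. -/
def activityRate (G : SimpleGraph V) (nu : V → ℝ) (u v : ActState G) : ℝ :=
  ∑ i, ((if i ∉ u.1 ∧ v.1 = insert i u.1 then nu i else 0)
      + (if i ∈ u.1 ∧ v.1 = u.1.erase i then 1 else 0))

/-- The generator matrix of the activity process. -/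
def generator (G : SimpleGraph V) (nu : V → ℝ) : Matrix (ActState G) (ActState G) ℝ :=
  Matrix.of (activityRate G nu) - Matrix.diagonal (fun u => ∑ v, activityRate G nu u v)

/-- `transProb G nu t u v` is the probability of `U(t) = v` given `U(0) = u`. -/
def transProb (G : SimpleGraph V) (nu : V → ℝ) (t : ℝ) (u v : ActState G) : ℝ :=
  NormedSpace.exp (t • generator G nu) u v

/-- The stationary distribution of the activity process, in product form. -/
def equilibrium (G : SimpleGraph V) (nu : V → ℝ) (u : ActState G) : ℝ :=
  (∏ i ∈ u.1, nu i) / ∑ v : ActState G, ∏ i ∈ v.1, nu i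

/-- Maximal distance in total variation between the law of `U(t)` and the equilibrium. -/
def mixDist (G : SimpleGraph V) (nu : V → ℝ) (t : ℝ) : ℝ :=
  ⨆ u₀ : ActState G, (1 / 2) * ∑ u, |transProb G nu t u₀ u - equilibrium G nu u|

/-- The mixing time of the activity process; it is `⊤` if the distance `ε` is never reached. -/
def mixingTime (G : SimpleGraph V) (nu : V → ℝ) (ε : ℝ) : EReal :=
  sInf ((fun t : ℝ => (t : EReal)) '' {t : ℝ | 0 ≤ t ∧ mixDist G nu t ≤ ε})

/-! `equilibrium` is indeed a probability distribution which satisfies detailed balance. -/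

instance (G : SimpleGraph V) : Nonempty (ActState G) := ⟨⟨∅, by simp⟩⟩

theorem equilibrium_pos (G : SimpleGraph V) (nu : V → ℝ) (hnu : ∀ i, 0 < nu i)
    (u : ActState G) : 0 < equilibrium G nu u :=
  div_pos (Finset.prod_pos fun i _ => hnu i)
    (Finset.sum_pos (fun _ _ => Finset.prod_pos fun i _ => hnu i) Finset.univ_nonempty)

theorem sum_equilibrium (G : SimpleGraph V) (nu : V → ℝ) (hnu : ∀ i, 0 < nu i) :
    ∑ u, equilibrium G nu u = 1 := by
  unfold equilibrium
  rw [← Finset.sum_div]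
  exact div_self (Finset.sum_pos (fun _ _ => Finset.prod_pos fun i _ => hnu i)
    Finset.univ_nonempty).ne'

theorem equilibrium_balance (G : SimpleGraph V) (nu : V → ℝ) (u v : ActState G) :
    equilibrium G nu u * activityRate G nu u v = equilibrium G nu v * activityRate G nu v u := by
  have key : ∀ (a b : Finset V) (i : V),
      (∏ j ∈ a, nu j) * (if i ∉ a ∧ b = insert i a then nu i else 0)
        = (∏ j ∈ b, nu j) * (if i ∈ b ∧ a = b.erase i then 1 else 0) := by
    intro a b i
    by_cases h : i ∉ a ∧ b = insert i a
    · obtain ⟨h1, rfl⟩ := h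
      simp [h1, Finset.prod_insert, mul_comm]
    · have h' : ¬ (i ∈ b ∧ a = b.erase i) := by
        rintro ⟨h1, rfl⟩
        exact h ⟨by simp, (Finset.insert_erase h1).symm⟩
      simp only [if_neg h, if_neg h', mul_zero]
  unfold equilibrium activityRate
  rw [div_mul_eq_mul_div, div_mul_eq_mul_div, Finset.mul_sum, Finset.mul_sum]
  congr 1
  refine Finset.sum_congr rfl fun i _ => ?_
  rw [mul_add, mul_add, key u.1 v.1 i, ← key v.1 u.1 i, add_comm]

/-! ### Loads and component sizes of a partite graph with components `V_k = comp ⁻¹' {k}` -/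

/-- The size `M` of the largest component. -/
def maxSize {K : ℕ} (comp : V → Fin K) : ℕ :=
  Finset.univ.sup fun k => (Finset.univ.filter fun i => comp i = k).card

/-- The total load `ρ`, the sum of the loads `r k` of the components. -/
def totalLoad {K : ℕ} (r : Fin K → ℝ) : ℝ := ∑ k, r k

/-- The smallest load `ρ_min` of a component. -/
def minLoad {K : ℕ} (r : Fin K → ℝ) : ℝ := ⨅ k, r k

end RandomAccess

end

/-! Stability forces large activation rates, and large activation rates create a bottleneck.

Write `ρ_k` for the load of each node of `V_k`. If the joint process is positive recurrent, its
occupation measure over a return cycle is finite and invariant. Balancing arrivals and departures at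
the queue of `i` shows that `i` is active for a fraction of time exceeding its load
(`load_lt_activeProb`). Here the activity marginal of the occupation measure is proportional to `π`,
by uniqueness of stationary measures.

Take one node in each component. Their activity events are disjoint, and also disjoint from the
event that the active set lies in `V_k` without its chosen node `i`. This last event therefore has
probability `restProb < 1 - ρ`. By the product form `π(i active) = ν_i * restProb`, so `ν_i ≥ ρ_min
/ (1 - ρ) =: b` (`div_le_activation_rate`).

Now let `V_k` be a largest component and `S` the set of states where it is active. The process
leaves `S` only through a jump `{i} → ∅`, at rate 1, and `π({i}) * ∏ (1 + ν_j) ≤ π(S)` with `j` over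
the other nodes of `V_k`. So the flow out of `S` is at most `M * π(S) / b ^ (M - 1)`. A chain that
is `ε`-mixed at time `t` satisfies `π(S) * (π(Sᶜ) - ε) ≤ t * flow` (`bottleneck`), and `π(Sᶜ) > (K -
1) * ρ_min` because the other components need their share of time. This gives a bound slightly
stronger than the one claimed. -/

open scoped ENNReal

noncomputable section

/-! ### Invariant measures and flow balance for countable chains -/

namespace RateChain

variable {S : Type*}

/-- The expected time spent in `y` between two visits to `z`. -/
def occupation (q : S → S → ℝ≥0∞) (z y : S) : ℝ≥0∞ :=
  ∑' n, taboo q z n y * (exitRate q y)⁻¹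

theorem tsum_occupation (q : S → S → ℝ≥0∞) (z : S) :
    ∑' y, occupation q z y = meanReturnTime q z :=
  ENNReal.tsum_comm

theorem occupation_self_ne_zero (q : S → S → ℝ≥0∞) (z : S) (hz : exitRate q z ≠ ∞) :
    occupation q z z ≠ 0 := by
  intro h
  have := ENNReal.tsum_eq_zero.1 h 0
  simp [taboo, hz] at this

/-- The occupation measure of a recurrent chain is invariant. -/
theorem occupation_invariant (q : S → S → ℝ≥0∞) (h0 : ∀ x, exitRate q x ≠ 0)
    (htop : ∀ x, exitRate q x ≠ ∞) (z : S) (hret : returnProb q z = 1) (y : S) :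
    ∑' x, occupation q z x * q x y = occupation q z y * exitRate q y := by
  have hL : ∑' x, occupation q z x * q x y = ∑' n, ∑' x, taboo q z n x * jumpProb q x y := by
    rw [ENNReal.tsum_comm]
    refine tsum_congr fun x => ?_
    rw [occupation, ← ENNReal.tsum_mul_right]
    refine tsum_congr fun n => ?_
    rw [jumpProb, div_eq_mul_inv, mul_assoc, mul_comm (q x y)]
  have hR : occupation q z y * exitRate q y = ∑' n, taboo q z n y := by
    rw [occupation, ← ENNReal.tsum_mul_right]
    refine tsum_congr fun n => ?_
    rw [mul_assoc, ENNReal.inv_mul_cancel (h0 y) (htop y), mul_one]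
  -- Split off time `0`. For `y = z` only that term survives and recurrence supplies the other side;
  -- for `y ≠ z` it vanishes and the shifted sum is the recursion of `taboo`.
  rw [hL, hR, tsum_eq_zero_add' (f := fun n => taboo q z n y) ENNReal.summable]
  by_cases hy : y = z
  · subst hy
    simp only [taboo, if_true, tsum_zero, add_zero]
    exact hret
  · simp [taboo, hy]

/-- In equilibrium the flow into a set equals the flow out of it. -/
theorem flow_balance (q : S → S → ℝ≥0∞) (μ : S → ℝ≥0∞)
    (hinv : ∀ y, ∑' x, μ x * q x y = μ y * exitRate q y) (f g : S → ℝ≥0∞)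
    (hfg : ∀ x, f x + g x = 1) (hfin : ∑' x, μ x * exitRate q x ≠ ∞) :
    ∑' x, μ x * g x * ∑' y, q x y * f y = ∑' x, μ x * f x * ∑' y, q x y * g y := by
  have hsplit : ∀ x, ∑' y, q x y * f y + ∑' y, q x y * g y = exitRate q x := by
    intro x
    rw [← ENNReal.tsum_add, exitRate]
    refine tsum_congr fun y => ?_
    rw [← mul_add, hfg, mul_one]
  have h1 : ∑' x, μ x * ∑' y, q x y * f y = ∑' x, μ x * f x * exitRate q x := by
    simp_rw [← ENNReal.tsum_mul_left]
    rw [ENNReal.tsum_comm]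
    refine tsum_congr fun y => ?_
    simp_rw [← mul_assoc]
    rw [ENNReal.tsum_mul_right, hinv, mul_right_comm]
  have h2 : ∑' x, μ x * ∑' y, q x y * f y
      = ∑' x, μ x * f x * ∑' y, q x y * f y + ∑' x, μ x * g x * ∑' y, q x y * f y := by
    rw [← ENNReal.tsum_add]
    refine tsum_congr fun x => ?_
    rw [← add_mul, ← mul_add, hfg, mul_one]
  have h3 : ∑' x, μ x * f x * exitRate q x
      = ∑' x, μ x * f x * ∑' y, q x y * f y + ∑' x, μ x * f x * ∑' y, q x y * g y := by
    rw [← ENNReal.tsum_add]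
    refine tsum_congr fun x => ?_
    rw [← mul_add, hsplit]
  -- The flow internal to `f` occurs on both sides; it can be cancelled in `ℝ≥0∞` only because it is
  -- finite.
  have hf : ∑' x, μ x * f x * ∑' y, q x y * f y ≠ ∞ := by
    refine ne_top_of_le_ne_top hfin (ENNReal.tsum_le_tsum fun x => ?_)
    refine mul_le_mul' ?_ ((hsplit x).symm ▸ le_self_add)
    exact mul_le_of_le_one_right' ((hfg x).symm ▸ le_self_add)
  rw [h2, h3] at h1
  exact (ENNReal.add_right_inj hf).1 h1

end RateChain

/-! ### Matrix semigroups of finite Markov chains -/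

section MarkovSemigroup

variable {n : Type*} [Fintype n] [DecidableEq n]

theorem Matrix.exp_apply_nonneg (A : Matrix n n ℝ) (hA : ∀ i j, 0 ≤ A i j) (i j : n) :
    0 ≤ NormedSpace.exp A i j := by
  open scoped Matrix.Norms.Operator in
  have hpow : ∀ k : ℕ, ∀ i j, 0 ≤ (A ^ k) i j := by
    intro k
    induction k with
    | zero => intro i j; rw [pow_zero, Matrix.one_apply]; split_ifs <;> norm_num
    | succ k ih =>
      intro i j
      rw [pow_succ, Matrix.mul_apply]
      exact Finset.sum_nonneg fun l _ => mul_nonneg (ih i l) (hA l j)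
  have h : HasSum (fun k : ℕ => ((k.factorial : ℝ))⁻¹ • A ^ k) (NormedSpace.exp A) :=
    NormedSpace.exp_series_hasSum_exp' (𝕂 := ℝ) A
  have hij : HasSum (fun k : ℕ => (((k.factorial : ℝ))⁻¹ • A ^ k) i j) (NormedSpace.exp A i j) :=
    h.map (Matrix.entryAddMonoidHom ℝ i j) (continuous_id.matrix_elem i j)
  refine hij.nonneg fun k => ?_
  rw [Matrix.smul_apply, smul_eq_mul]
  exact mul_nonneg (by positivity) (hpow k i j)

/-- The semigroup generated by a matrix with nonnegative off-diagonal entries is nonnegative. -/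
theorem Matrix.exp_apply_nonneg_of_offDiag (A : Matrix n n ℝ) (hA : ∀ i j, i ≠ j → 0 ≤ A i j)
    (i j : n) : 0 ≤ NormedSpace.exp A i j := by
  -- Adding `c • 1` makes all entries nonnegative; as it commutes with `A`, it changes the
  -- exponential only by a positive scalar factor.
  set c : ℝ := ∑ k, |A k k| with hc
  have hck : ∀ k, 0 ≤ A k k + c := fun k => by
    have h1 : |A k k| ≤ c :=
      Finset.single_le_sum (f := fun k => |A k k|) (fun k _ => abs_nonneg _) (Finset.mem_univ k)
    linarith [neg_abs_le (A k k)]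
  have hcomm : Commute (A + c • (1 : Matrix n n ℝ)) (Matrix.diagonal fun _ => -c) := by
    have : (Matrix.diagonal fun _ => -c : Matrix n n ℝ) = (-c) • 1 := by
      ext a b; simp [Matrix.diagonal_apply, Matrix.one_apply]
    rw [this]
    exact (Commute.one_right _).smul_right _
  have hsum : A = (A + c • (1 : Matrix n n ℝ)) + Matrix.diagonal fun _ => -c := by
    ext a b
    by_cases hab : a = b <;> simp [hab]
  rw [hsum, Matrix.exp_add_of_commute _ _ hcomm, Matrix.exp_diagonal, Matrix.mul_diagonal]
  refine mul_nonneg (Matrix.exp_apply_nonneg _ (fun a b => ?_) i j) ?_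
  · by_cases hab : a = b
    · subst hab; simpa using hck a
    · simpa [Matrix.one_apply, hab] using hA a b hab
  · rw [Pi.coe_exp, ← Real.exp_eq_exp_ℝ]
    exact (Real.exp_pos _).le

/-- The bilinear form of a matrix, as a linear map in the matrix. -/
def Matrix.dotProductMulVec (a b : n → ℝ) : Matrix n n ℝ →ₗ[ℝ] ℝ where
  toFun X := a ⬝ᵥ (X.mulVec b)
  map_add' X Y := by rw [Matrix.add_mulVec, dotProduct_add]
  map_smul' c X := by rw [Matrix.smul_mulVec, dotProduct_smul]; rfl

theorem Matrix.hasDerivAt_dotProduct_exp (Q : Matrix n n ℝ) (a b : n → ℝ) (t : ℝ) :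
    HasDerivAt (fun t : ℝ => a ⬝ᵥ ((NormedSpace.exp (t • Q)).mulVec b))
      (a ⬝ᵥ ((NormedSpace.exp (t • Q) * Q).mulVec b)) t := by
  open scoped Matrix.Norms.Operator in
  exact (LinearMap.toContinuousLinearMap (Matrix.dotProductMulVec a b)).hasFDerivAt.comp_hasDerivAt t
    (hasDerivAt_exp_smul_const Q t)

theorem Matrix.hasDerivAt_dotProduct_exp' (Q : Matrix n n ℝ) (a b : n → ℝ) (t : ℝ) :
    HasDerivAt (fun t : ℝ => a ⬝ᵥ ((NormedSpace.exp (t • Q)).mulVec b))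
      (a ⬝ᵥ ((Q * NormedSpace.exp (t • Q)).mulVec b)) t := by
  open scoped Matrix.Norms.Operator in
  exact (LinearMap.toContinuousLinearMap (Matrix.dotProductMulVec a b)).hasFDerivAt.comp_hasDerivAt t
    (hasDerivAt_exp_smul_const' Q t)

/-- The derivative in `t` is `exp (t • Q) * Q` applied to the constant vector, which `Q` kills, so
the row sums keep their value at `t = 0`. -/
theorem Matrix.exp_mulVec_one (Q : Matrix n n ℝ) (hQ : ∀ i, ∑ j, Q i j = 0) (t : ℝ) (i : n) :
    ∑ j, NormedSpace.exp (t • Q) i j = 1 := by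
  have hQ1 : Q.mulVec 1 = 0 := by
    ext i
    simpa [Matrix.mulVec, dotProduct] using hQ i
  have hd : ∀ t, HasDerivAt
      (fun t : ℝ => Pi.single i (1 : ℝ) ⬝ᵥ ((NormedSpace.exp (t • Q)).mulVec 1)) 0 t := by
    intro t
    have h := Matrix.hasDerivAt_dotProduct_exp Q (Pi.single i 1) 1 t
    rwa [← Matrix.mulVec_mulVec, hQ1, Matrix.mulVec_zero, dotProduct_zero] at h
  have h := is_const_of_deriv_eq_zero (fun t => (hd t).differentiableAt) (fun t => (hd t).deriv) t 0
  have hX : ∀ X : Matrix n n ℝ, Pi.single i (1 : ℝ) ⬝ᵥ X.mulVec 1 = ∑ j, X i j := by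
    intro X
    rw [single_dotProduct, one_mul]
    simp [Matrix.mulVec, dotProduct]
  rw [hX, hX, zero_smul, NormedSpace.exp_zero] at h
  rw [h]
  simp [Matrix.one_apply]

/-- Dual to the conservation of row sums: with `Q` written on the left of the exponential, the
derivative contains `p Q = 0`. -/
theorem Matrix.vecMul_exp (Q : Matrix n n ℝ) (p : n → ℝ) (hp : Matrix.vecMul p Q = 0) (t : ℝ) :
    Matrix.vecMul p (NormedSpace.exp (t • Q)) = p := by
  ext j
  have hd : ∀ t, HasDerivAt
      (fun t : ℝ => p ⬝ᵥ ((NormedSpace.exp (t • Q)).mulVec (Pi.single j 1))) 0 t := by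
    intro t
    have h := Matrix.hasDerivAt_dotProduct_exp' Q p (Pi.single j 1) t
    rwa [← Matrix.mulVec_mulVec, Matrix.dotProduct_mulVec, hp, zero_dotProduct] at h
  have h := is_const_of_deriv_eq_zero (fun t => (hd t).differentiableAt) (fun t => (hd t).deriv) t 0
  have hX : ∀ X : Matrix n n ℝ, p ⬝ᵥ X.mulVec (Pi.single j 1) = Matrix.vecMul p X j := by
    intro X
    rw [Matrix.dotProduct_mulVec, dotProduct_single, mul_one]
  rw [hX, hX, zero_smul, NormedSpace.exp_zero, Matrix.vecMul_one] at h
  exact h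

/-- A stationary Markov chain leaves a set `s` before time `t` with probability at most `t` times
the stationary flow out of `s`. -/
theorem Matrix.sum_exp_le_flow (Q : Matrix n n ℝ) (hQ : ∀ i j, i ≠ j → 0 ≤ Q i j)
    (hQ0 : ∀ i, ∑ j, Q i j = 0) (p : n → ℝ) (hp : ∀ i, 0 ≤ p i) (hpQ : Matrix.vecMul p Q = 0)
    (s : Finset n) (t : ℝ) (ht : 0 ≤ t) :
    ∑ i ∈ s, ∑ j ∈ sᶜ, p i * NormedSpace.exp (t • Q) i j
      ≤ t * ∑ i ∈ s, ∑ j ∈ sᶜ, p i * Q i j := by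
  -- `a` is the stationary law restricted to `s` and `b` the indicator of the complement, so `a ⬝ᵥ X
  -- b` measures the mass that `X` carries from `s` to `sᶜ`.
  set a : n → ℝ := fun i => if i ∈ s then p i else 0 with ha
  set b : n → ℝ := fun j => if j ∈ sᶜ then 1 else 0 with hb
  have key : ∀ X : Matrix n n ℝ, a ⬝ᵥ (X.mulVec b) = ∑ i ∈ s, ∑ j ∈ sᶜ, p i * X i j := by
    intro X
    have h1 : ∀ i, X.mulVec b i = ∑ j ∈ sᶜ, X i j := by
      intro i
      simp only [Matrix.mulVec, dotProduct, hb, mul_ite, mul_one, mul_zero]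
      rw [Finset.sum_ite_mem, Finset.univ_inter]
    simp only [dotProduct, h1, ha, ite_mul, zero_mul]
    rw [Finset.sum_ite_mem, Finset.univ_inter]
    simp_rw [Finset.mul_sum]
  rw [← key, ← key]
  have hQb : ∀ i, Q.mulVec b i = ∑ j ∈ sᶜ, Q i j := by
    intro i
    simp only [Matrix.mulVec, dotProduct, hb, mul_ite, mul_one, mul_zero]
    rw [Finset.sum_ite_mem, Finset.univ_inter]
  -- The mass that started in `s` is dominated by the stationary mass. On `s`, `Q b ≥ 0` and `a P ≤
  -- p = a`; off `s`, `Q b ≤ 0`, as mass can only return. So the flow is never larger than at time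
  -- `0`.
  have hderiv : ∀ τ : ℝ, 0 ≤ τ →
      a ⬝ᵥ ((NormedSpace.exp (τ • Q) * Q).mulVec b) ≤ a ⬝ᵥ (Q.mulVec b) := by
    intro τ hτ
    have hP : ∀ i j, 0 ≤ NormedSpace.exp (τ • Q) i j := fun i j =>
      Matrix.exp_apply_nonneg_of_offDiag _ (fun i j hij => mul_nonneg hτ (hQ i j hij)) i j
    have hstat := Matrix.vecMul_exp Q p hpQ τ
    set P := NormedSpace.exp (τ • Q)
    rw [← Matrix.mulVec_mulVec, Matrix.dotProduct_mulVec]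
    refine Finset.sum_le_sum fun i _ => ?_
    by_cases hi : i ∈ s
    · have h1 : Matrix.vecMul a P i ≤ a i := by
        have : a i = Matrix.vecMul p P i := by rw [hstat]; simp [ha, hi]
        rw [this]
        refine Finset.sum_le_sum fun j _ => mul_le_mul_of_nonneg_right ?_ (hP j i)
        simp only [ha]
        split_ifs
        · exact le_rfl
        · exact hp j
      refine mul_le_mul_of_nonneg_right h1 ?_
      rw [hQb]
      refine Finset.sum_nonneg fun j hj => hQ i j ?_
      rintro rfl
      exact Finset.mem_compl.1 hj hi
    · have h0 : a i = 0 := by simp [ha, hi]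
      rw [h0, zero_mul]
      refine mul_nonpos_of_nonneg_of_nonpos ?_ ?_
      · refine Finset.sum_nonneg fun j _ => mul_nonneg ?_ (hP j i)
        simp only [ha]
        split_ifs
        · exact hp j
        · exact le_rfl
      · rw [hQb]
        have h2 := Finset.sum_add_sum_compl s (Q i)
        rw [hQ0] at h2
        have h3 : 0 ≤ ∑ j ∈ s, Q i j := Finset.sum_nonneg fun j hj => hQ i j (by
          rintro rfl
          exact hi hj)
        linarith
  set F : ℝ := a ⬝ᵥ (Q.mulVec b) with hF
  have hd : ∀ τ, HasDerivAt (fun τ : ℝ => a ⬝ᵥ ((NormedSpace.exp (τ • Q)).mulVec b) - τ * F)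
      (a ⬝ᵥ ((NormedSpace.exp (τ • Q) * Q).mulVec b) - F) τ := by
    intro τ
    exact (Matrix.hasDerivAt_dotProduct_exp Q a b τ).sub (hasDerivAt_mul_const F)
  have hanti := antitoneOn_of_deriv_nonpos (convex_Ici (0 : ℝ))
    (f := fun τ : ℝ => a ⬝ᵥ ((NormedSpace.exp (τ • Q)).mulVec b) - τ * F)
    (fun τ _ => (hd τ).continuousAt.continuousWithinAt)
    (fun τ _ => (hd τ).differentiableAt.differentiableWithinAt)
    (fun τ hτ => by
      rw [(hd τ).deriv, sub_nonpos]
      rw [interior_Ici] at hτ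
      exact hderiv τ (le_of_lt hτ))
  have h := hanti (Set.mem_Ici.2 le_rfl) (Set.mem_Ici.2 ht) ht
  have h0 : a ⬝ᵥ ((1 : Matrix n n ℝ).mulVec b) = 0 := by
    rw [Matrix.one_mulVec]
    refine Finset.sum_eq_zero fun i _ => ?_
    by_cases hi : i ∈ s <;> simp [ha, hb, hi]
  simp only [zero_smul, NormedSpace.exp_zero, h0, zero_mul, sub_zero] at h
  linarith

end MarkovSemigroup

/-! ### The activity process and its bottleneck bound -/

namespace RandomAccess

variable {V : Type*} [Fintype V] [DecidableEq V]

theorem activityRate_nonneg (G : SimpleGraph V) (nu : V → ℝ) (hnu : ∀ i, 0 < nu i)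
    (u v : ActState G) : 0 ≤ activityRate G nu u v := by
  refine Finset.sum_nonneg fun i _ => add_nonneg ?_ ?_ <;> split_ifs <;>
    first | exact (hnu i).le | norm_num

theorem generator_apply_of_ne (G : SimpleGraph V) (nu : V → ℝ) {u v : ActState G} (h : u ≠ v) :
    generator G nu u v = activityRate G nu u v := by
  simp [generator, h]

theorem sum_generator (G : SimpleGraph V) (nu : V → ℝ) (u : ActState G) :
    ∑ v, generator G nu u v = 0 := by
  simp [generator, Matrix.diagonal_apply, Finset.sum_sub_distrib]

theorem vecMul_generator (G : SimpleGraph V) (nu : V → ℝ) :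
    Matrix.vecMul (equilibrium G nu) (generator G nu) = 0 := by
  ext v
  simp only [Matrix.vecMul, dotProduct, generator, Matrix.sub_apply, Matrix.of_apply, mul_sub,
    Finset.sum_sub_distrib, Pi.zero_apply, Matrix.diagonal_apply, mul_ite, mul_zero,
    Finset.sum_ite_eq', Finset.mem_univ, if_true]
  rw [Finset.mul_sum, sub_eq_zero]
  exact Finset.sum_congr rfl fun u _ => equilibrium_balance G nu u v

theorem mixDist_nonneg (G : SimpleGraph V) (nu : V → ℝ) (t : ℝ) : 0 ≤ mixDist G nu t :=
  Real.iSup_nonneg fun _ => mul_nonneg (by norm_num) (Finset.sum_nonneg fun _ _ => abs_nonneg _)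

/-- The difference of two probability vectors sums to zero, so its sum over an event is half the
difference between the sums over the event and its complement, hence at most half the `ℓ¹` norm. -/
theorem sum_sub_le_mixDist (G : SimpleGraph V) (nu : V → ℝ) (hnu : ∀ i, 0 < nu i) (t : ℝ)
    (s : Finset (ActState G)) (u₀ : ActState G) :
    ∑ u ∈ s, (equilibrium G nu u - transProb G nu t u₀ u) ≤ mixDist G nu t := by
  have h1 : (1 / 2) * ∑ u, |transProb G nu t u₀ u - equilibrium G nu u| ≤ mixDist G nu t :=
    le_ciSup (f := fun u₀ => (1 / 2) * ∑ u, |transProb G nu t u₀ u - equilibrium G nu u|)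
      (Set.finite_range _).bddAbove u₀
  refine le_trans ?_ h1
  set f : ActState G → ℝ := fun u => equilibrium G nu u - transProb G nu t u₀ u with hf
  have hsum : ∑ u, f u = 0 := by
    simp only [hf, Finset.sum_sub_distrib, sum_equilibrium G nu hnu]
    rw [show ∑ u, transProb G nu t u₀ u = 1 from
      Matrix.exp_mulVec_one _ (sum_generator G nu) t u₀, sub_self]
  have habs : ∑ u, |transProb G nu t u₀ u - equilibrium G nu u| = ∑ u, |f u| :=
    Finset.sum_congr rfl fun u _ => abs_sub_comm _ _
  rw [habs, ← Finset.sum_add_sum_compl s (fun u => |f u|)]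
  rw [← Finset.sum_add_sum_compl s f] at hsum
  have h2 : ∑ u ∈ s, f u ≤ ∑ u ∈ s, |f u| := Finset.sum_le_sum fun u _ => le_abs_self _
  have h3 : -∑ u ∈ sᶜ, f u ≤ ∑ u ∈ sᶜ, |f u| := by
    rw [← Finset.sum_neg_distrib]
    exact Finset.sum_le_sum fun u _ => neg_le_abs _
  linarith

/-- The bottleneck bound: the activity process cannot mix before the flow through the boundary
of a set of states has carried enough mass out of it. -/
theorem bottleneck (G : SimpleGraph V) (nu : V → ℝ) (hnu : ∀ i, 0 < nu i) (t ε : ℝ) (ht : 0 ≤ t)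
    (hε : mixDist G nu t ≤ ε) (s : Finset (ActState G)) :
    (∑ u ∈ s, equilibrium G nu u) * (∑ u ∈ sᶜ, equilibrium G nu u - ε)
      ≤ t * ∑ u ∈ s, ∑ v ∈ sᶜ, equilibrium G nu u * activityRate G nu u v := by
  have h1 := Matrix.sum_exp_le_flow (generator G nu)
    (fun u v huv => by
      rw [generator_apply_of_ne G nu huv]; exact activityRate_nonneg G nu hnu u v)
    (sum_generator G nu) (equilibrium G nu) (fun u => (equilibrium_pos G nu hnu u).le)
    (vecMul_generator G nu) s t ht
  have h2 : ∑ u ∈ s, ∑ v ∈ sᶜ, equilibrium G nu u * generator G nu u v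
      = ∑ u ∈ s, ∑ v ∈ sᶜ, equilibrium G nu u * activityRate G nu u v := by
    refine Finset.sum_congr rfl fun u hu => Finset.sum_congr rfl fun v hv => ?_
    rw [generator_apply_of_ne]
    rintro rfl
    exact Finset.mem_compl.1 hv hu
  rw [h2] at h1
  refine le_trans ?_ h1
  rw [Finset.sum_mul]
  refine Finset.sum_le_sum fun u _ => ?_
  rw [← Finset.mul_sum]
  refine mul_le_mul_of_nonneg_left ?_ (equilibrium_pos G nu hnu u).le
  -- From every start in `s`, the law at time `t` gives `sᶜ` mass at least `π(sᶜ) - ε`.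
  have h3 := (sum_sub_le_mixDist G nu hnu t sᶜ u).trans hε
  rw [Finset.sum_sub_distrib] at h3
  simp only [transProb] at h3
  linarith

end RandomAccess

/-! ### From positive recurrence to a lower bound on activity -/

theorem ENNReal.tsum_ite_and_eq {α : Type*} (P : Prop) [Decidable P] [DecidableEq α] (c : α)
    (a : ℝ≥0∞) : ∑' x, (if P ∧ x = c then a else 0) = if P then a else 0 := by
  by_cases hP : P
  · simp only [hP, true_and, if_true]
    exact tsum_ite_eq c _
  · simp [hP]

namespace RandomAccess

variable {V : Type*} [Fintype V] [DecidableEq V]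

theorem ofReal_activityRate (G : SimpleGraph V) (nu : V → ℝ) (hnu : ∀ i, 0 < nu i)
    (u v : ActState G) : ENNReal.ofReal (activityRate G nu u v)
      = ∑ i, ((if i ∉ u.1 ∧ v.1 = insert i u.1 then ENNReal.ofReal (nu i) else 0)
        + (if i ∈ u.1 ∧ v.1 = u.1.erase i then 1 else 0)) := by
  have h1 : ∀ i, 0 ≤ if i ∉ u.1 ∧ v.1 = insert i u.1 then nu i else 0 := fun i => by
    split_ifs
    · exact (hnu i).le
    · exact le_rfl
  have h2 : ∀ i, (0 : ℝ) ≤ if i ∈ u.1 ∧ v.1 = u.1.erase i then 1 else 0 := fun i => by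
    split_ifs <;> norm_num
  rw [activityRate, ENNReal.ofReal_sum_of_nonneg fun i _ => add_nonneg (h1 i) (h2 i)]
  refine Finset.sum_congr rfl fun i _ => ?_
  rw [ENNReal.ofReal_add (h1 i) (h2 i), apply_ite ENNReal.ofReal, apply_ite ENNReal.ofReal,
    ENNReal.ofReal_zero, ENNReal.ofReal_one]

/-- The total rate from a network state to the states with a given activity pattern. -/
theorem tsum_networkRate (G : SimpleGraph V) (lam nu : V → ℝ) (hnu : ∀ i, 0 < nu i)
    (u w : ActState G) (X : V → ℕ) :
    ∑' X', networkRate G lam nu (u, X) (w, X')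
      = (if w = u then ∑ i, ENNReal.ofReal (lam i) else 0)
        + ENNReal.ofReal (activityRate G nu u w) := by
  rw [ofReal_activityRate G nu hnu]
  simp only [networkRate]
  rw [Summable.tsum_finsetSum fun _ _ => ENNReal.summable]
  have h : ∀ i, ∑' X' : V → ℕ,
      ((if w = u ∧ X' = X + Pi.single i 1 then ENNReal.ofReal (lam i) else 0)
      + (if i ∉ u.1 ∧ w.1 = insert i u.1 ∧ X' = X then ENNReal.ofReal (nu i) else 0)
      + (if i ∈ u.1 ∧ w.1 = u.1.erase i ∧ X' = X - Pi.single i 1 then 1 else 0))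
      = (if w = u then ENNReal.ofReal (lam i) else 0)
        + ((if i ∉ u.1 ∧ w.1 = insert i u.1 then ENNReal.ofReal (nu i) else 0)
        + (if i ∈ u.1 ∧ w.1 = u.1.erase i then 1 else 0)) := by
    intro i
    rw [ENNReal.tsum_add, ENNReal.tsum_add, ENNReal.tsum_ite_and_eq]
    simp_rw [← and_assoc]
    rw [ENNReal.tsum_ite_and_eq, ENNReal.tsum_ite_and_eq, add_assoc]
  rw [Finset.sum_congr rfl fun i _ => h i, Finset.sum_add_distrib]
  congr 1
  split_ifs
  · rfl
  · simp

theorem exitRate_networkRate (G : SimpleGraph V) (lam nu : V → ℝ) (hnu : ∀ i, 0 < nu i)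
    (s : ActState G × (V → ℕ)) :
    RateChain.exitRate (networkRate G lam nu) s
      = ∑ i, ENNReal.ofReal (lam i) + ∑ w, ENNReal.ofReal (activityRate G nu s.1 w) := by
  obtain ⟨u, X⟩ := s
  rw [RateChain.exitRate, ENNReal.tsum_prod', tsum_fintype]
  simp_rw [tsum_networkRate G lam nu hnu]
  rw [Finset.sum_add_distrib, Finset.sum_ite_eq' Finset.univ u, if_pos (Finset.mem_univ u)]

/-- The equilibrium distribution is the only stationary measure of the activity process,
up to a constant factor. -/
theorem eq_smul_equilibrium (G : SimpleGraph V) (nu : V → ℝ) (hnu : ∀ i, 0 < nu i)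
    (m : ActState G → ℝ)
    (hm : ∀ w, ∑ u, m u * activityRate G nu u w = m w * ∑ v, activityRate G nu w v)
    (w : ActState G) : m w = (∑ u, m u) * equilibrium G nu w := by
  set p := equilibrium G nu with hp
  have hp0 : ∀ u, 0 < p u := equilibrium_pos G nu hnu
  set h : ActState G → ℝ := fun u => m u / p u with hh
  have hmh : ∀ u, m u = p u * h u := fun u => by
    rw [hh]; field_simp [(hp0 u).ne']
  have hharm : ∀ w, ∑ u, p w * activityRate G nu w u * (h u - h w) = 0 := by
    intro w
    have h1 := hm w
    rw [Finset.mul_sum] at h1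
    simp_rw [mul_sub]
    rw [Finset.sum_sub_distrib, sub_eq_zero]
    calc ∑ u, p w * activityRate G nu w u * h u = ∑ u, m u * activityRate G nu u w := by
          refine Finset.sum_congr rfl fun u _ => ?_
          rw [hp, equilibrium_balance, ← hp, hmh u]; ring
      _ = ∑ u, m w * activityRate G nu w u := h1
      _ = ∑ u, p w * activityRate G nu w u * h w := by
          refine Finset.sum_congr rfl fun u _ => ?_
          rw [hmh w]; ring
  -- The density `h = m / p` is harmonic; summation by parts, using reversibility, makes its
  -- Dirichlet form vanish, so `h` is constant along transitions.
  have hdir : ∑ w, ∑ u, p w * activityRate G nu w u * (h u - h w) ^ 2 = 0 := by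
    have e1 : ∑ w, ∑ u, p w * activityRate G nu w u * (h u - h w) * h w = 0 := by
      refine Finset.sum_eq_zero fun w _ => ?_
      rw [← Finset.sum_mul, hharm, zero_mul]
    have e2 : ∑ w, ∑ u, p w * activityRate G nu w u * (h u - h w) * h u
        = -∑ w, ∑ u, p w * activityRate G nu w u * (h u - h w) * h w := by
      rw [Finset.sum_comm, ← Finset.sum_neg_distrib]
      refine Finset.sum_congr rfl fun u _ => ?_
      rw [← Finset.sum_neg_distrib]
      refine Finset.sum_congr rfl fun w _ => ?_
      rw [hp, equilibrium_balance]
      ring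
    have e3 : ∑ w, ∑ u, p w * activityRate G nu w u * (h u - h w) ^ 2
        = ∑ w, ∑ u, p w * activityRate G nu w u * (h u - h w) * h u
          - ∑ w, ∑ u, p w * activityRate G nu w u * (h u - h w) * h w := by
      simp_rw [← Finset.sum_sub_distrib]
      refine Finset.sum_congr rfl fun w _ => Finset.sum_congr rfl fun u _ => by ring
    rw [e3, e2, e1]; simp
  have hnn : ∀ w u, 0 ≤ p w * activityRate G nu w u * (h u - h w) ^ 2 := fun w u =>
    mul_nonneg (mul_nonneg (hp0 w).le (activityRate_nonneg G nu hnu w u)) (sq_nonneg _)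
  have hedge : ∀ w u, 0 < activityRate G nu w u → h u = h w := by
    intro w u hwu
    have h1 := (Finset.sum_eq_zero_iff_of_nonneg fun w _ =>
      Finset.sum_nonneg fun u _ => hnn w u).1 hdir w (Finset.mem_univ w)
    have h2 := (Finset.sum_eq_zero_iff_of_nonneg fun u _ => hnn w u).1 h1 u (Finset.mem_univ u)
    have h3 : (h u - h w) ^ 2 = 0 :=
      (mul_eq_zero.1 h2).resolve_left (mul_pos (hp0 w) hwu).ne'
    exact sub_eq_zero.1 (pow_eq_zero_iff two_ne_zero |>.1 h3)
  have hdrop : ∀ (w u : ActState G) (i : V), i ∈ w.1 → u.1 = w.1.erase i → h u = h w := by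
    intro w u i hi hu
    refine hedge w u ?_
    refine lt_of_lt_of_le ?_ (Finset.single_le_sum (f := fun i =>
      (if i ∉ w.1 ∧ u.1 = insert i w.1 then nu i else 0)
      + (if i ∈ w.1 ∧ u.1 = w.1.erase i then (1 : ℝ) else 0)) (fun j _ => ?_) (Finset.mem_univ i))
    · simp [hi, hu]
    · refine add_nonneg ?_ ?_ <;> split_ifs <;> first | exact (hnu j).le | norm_num
  -- Every state is connected to the empty one by de-activating its nodes one at a time.
  have hconst : ∀ (k : ℕ) (w : ActState G), w.1.card = k → h w = h ⟨∅, by simp⟩ := by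
    intro k
    induction k with
    | zero =>
      intro w hw
      congr 1
      exact Subtype.ext (Finset.card_eq_zero.1 hw)
    | succ k ih =>
      intro w hw
      obtain ⟨i, hi⟩ : w.1.Nonempty := Finset.card_pos.1 (by omega)
      have hind : G.IsIndepSet ((w.1.erase i : Finset V) : Set V) :=
        w.2.mono (by exact_mod_cast Finset.erase_subset i w.1)
      rw [← hdrop w ⟨w.1.erase i, hind⟩ i hi rfl]
      exact ih _ (by rw [Finset.card_erase_of_mem hi, hw]; rfl)
  set c := h ⟨∅, by simp⟩
  have hmc : ∀ u, m u = c * p u := fun u => by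
    rw [hmh u, hconst _ u rfl, mul_comm]
  have hsum : ∑ u, m u = c := by
    simp_rw [hmc]
    rw [← Finset.mul_sum, hp, sum_equilibrium G nu hnu, mul_one]
  rw [hsum, hmc]

/-- The flow of arrivals which raise the queue at `i` from level `n` is at most the flow of
departures from level `n + 1`. -/
theorem queue_balance (G : SimpleGraph V) (lam nu : V → ℝ)
    (μ : ActState G × (V → ℕ) → ℝ≥0∞)
    (hinv : ∀ y, ∑' x, μ x * networkRate G lam nu x y
      = μ y * RateChain.exitRate (networkRate G lam nu) y)
    (hfin : ∑' x, μ x * RateChain.exitRate (networkRate G lam nu) x ≠ ∞) (i : V) (n : ℕ) :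
    ∑' x : ActState G × (V → ℕ), (if x.2 i = n then μ x * ENNReal.ofReal (lam i) else 0)
      ≤ ∑' x : ActState G × (V → ℕ), if x.2 i = n + 1 ∧ i ∈ x.1.1 then μ x else 0 := by
  -- Cut the state space at the event that the queue at `i` exceeds `n`.
  have hflow := RateChain.flow_balance (networkRate G lam nu) μ hinv
    (fun x => if n < x.2 i then 1 else 0) (fun x => if n < x.2 i then 0 else 1)
    (fun x => by split_ifs <;> simp) hfin
  refine le_trans (ENNReal.tsum_le_tsum fun x => ?_) (hflow.le.trans
    (ENNReal.tsum_le_tsum fun x => ?_))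
  · split_ifs with h1 h2
    · omega
    · rw [mul_one]
      refine mul_le_mul_right ?_ _
      refine le_trans ?_ (ENNReal.le_tsum (x.1, x.2 + Pi.single i 1))
      have : n < (x.2 + Pi.single i 1 : V → ℕ) i := by simp [h1]
      rw [if_pos this, mul_one, networkRate]
      refine le_trans ?_ (Finset.single_le_sum (fun _ _ => zero_le) (Finset.mem_univ i))
      rw [if_pos ⟨rfl, rfl⟩, add_assoc]
      exact le_self_add
    · exact zero_le
    · exact zero_le
  · by_cases hn : n < x.2 i
    swap
    · simp [hn]
    rw [if_pos hn, mul_one]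
    -- The only downward crossing of the cut is a completion at `i` from level `n + 1`, and it has a
    -- single target state.
    have hstay : ∀ (y : ActState G × (V → ℕ)), ¬ n < y.2 i → ∀ j,
        ((if y.1 = x.1 ∧ y.2 = x.2 + Pi.single j 1 then ENNReal.ofReal (lam j) else 0)
        + (if j ∉ x.1.1 ∧ y.1.1 = insert j x.1.1 ∧ y.2 = x.2 then ENNReal.ofReal (nu j) else 0)
        + (if j ∈ x.1.1 ∧ y.1.1 = x.1.1.erase j ∧ y.2 = x.2 - Pi.single j 1 then 1 else 0))
        ≤ if j = i then (if (x.2 i = n + 1 ∧ i ∈ x.1.1) ∧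
            y = (⟨x.1.1.erase i, x.1.2.mono (by exact_mod_cast Finset.erase_subset i x.1.1)⟩,
              x.2 - Pi.single i 1) then (1 : ℝ≥0∞) else 0) else 0 := by
      intro y hy j
      rw [if_neg, if_neg, zero_add, zero_add]
      · split_ifs with h1 h2 h3 h3
        · exact le_rfl
        · subst h2
          refine absurd ⟨⟨?_, h1.1⟩, Prod.ext (Subtype.ext h1.2.1) h1.2.2⟩ h3
          rw [h1.2.2, Pi.sub_apply, Pi.single_eq_same] at hy
          omega
        · rw [h1.2.2, Pi.sub_apply, Pi.single_eq_of_ne (Ne.symm h2)] at hy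
          omega
        · exact zero_le
        · exact zero_le
        · exact le_rfl
      · rintro ⟨-, -, h⟩
        exact hy (h ▸ hn)
      · rintro ⟨-, h⟩
        rw [h, Pi.add_apply] at hy
        omega
    have hrate : ∑' y, networkRate G lam nu x y * (if n < y.2 i then 0 else 1)
        ≤ if x.2 i = n + 1 ∧ i ∈ x.1.1 then 1 else 0 := by
      classical
      rw [← ENNReal.tsum_ite_and_eq (x.2 i = n + 1 ∧ i ∈ x.1.1)
        ((⟨x.1.1.erase i, x.1.2.mono (by exact_mod_cast Finset.erase_subset i x.1.1)⟩,
              x.2 - Pi.single i 1) : ActState G × (V → ℕ))]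
      refine ENNReal.tsum_le_tsum fun y => ?_
      by_cases hy : n < y.2 i
      · simp [hy]
      rw [if_neg hy, mul_one]
      refine (Finset.sum_le_sum fun j _ => hstay y hy j).trans ?_
      rw [Finset.sum_ite_eq' Finset.univ i, if_pos (Finset.mem_univ i)]
    calc μ x * ∑' y, networkRate G lam nu x y * (if n < y.2 i then 0 else 1)
        ≤ μ x * (if x.2 i = n + 1 ∧ i ∈ x.1.1 then 1 else 0) := mul_le_mul_right hrate _
      _ ≤ _ := by split_ifs <;> simp

/-- In a stable system every node is active for a larger fraction of time than its load. -/
theorem load_lt_activeProb (G : SimpleGraph V) (lam nu : V → ℝ) (hlam : ∀ i, 0 < lam i)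
    (hnu : ∀ i, 0 < nu i) (hst : Stable G lam nu) (i : V) :
    lam i < ∑ u : ActState G, if i ∈ u.1 then equilibrium G nu u else 0 := by
  set q := networkRate G lam nu with hq
  -- At `z` node `i` is active with an empty queue. The positive time spent there serves no packet,
  -- which makes the final inequality strict.
  set z : ActState G × (V → ℕ) := (⟨{i}, by simp⟩, 0) with hz
  have hexit := exitRate_networkRate G lam nu hnu
  have htop : ∀ s, RateChain.exitRate q s ≠ ∞ := fun s => by
    rw [hq, hexit]; simp [ENNReal.sum_eq_top]
  have h0 : ∀ s, RateChain.exitRate q s ≠ 0 := fun s => by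
    rw [hq, hexit]
    have : ∑ j, ENNReal.ofReal (lam j) ≠ 0 := fun h =>
      (ENNReal.ofReal_pos.2 (hlam i)).ne' (Finset.sum_eq_zero_iff.1 h i (Finset.mem_univ i))
    simp [this]
  obtain ⟨hret, hmean⟩ := hst z
  set μ := RateChain.occupation q z with hμ
  have hinv := RateChain.occupation_invariant q h0 htop z hret
  rw [← hμ] at hinv
  have hmass : ∑' x, μ x ≠ ∞ := by
    rw [hμ, RateChain.tsum_occupation]; exact hmean.ne
  have hμz : μ z ≠ 0 := RateChain.occupation_self_ne_zero q z (htop z)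
  have hfin : ∑' x, μ x * RateChain.exitRate q x ≠ ∞ := by
    -- Exit rates do not depend on the queues, so their sum over the finitely many activity patterns
    -- is a uniform bound.
    have hC : ∑ w, RateChain.exitRate q (w, 0) ≠ ∞ := by
      simp [ENNReal.sum_eq_top, htop]
    refine ne_top_of_le_ne_top (ENNReal.mul_ne_top hmass hC) ?_
    rw [← ENNReal.tsum_mul_right]
    refine ENNReal.tsum_le_tsum fun x => mul_le_mul_right ?_ _
    have : RateChain.exitRate q x = RateChain.exitRate q (x.1, 0) := by rw [hq, hexit, hexit]
    rw [this]
    exact Finset.single_le_sum (f := fun w => RateChain.exitRate q (w, 0))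
      (fun _ _ => zero_le) (Finset.mem_univ x.1)
  -- the queue at `i`
  have hqueue : (∑' x, μ x) * ENNReal.ofReal (lam i)
      < ∑' x : ActState G × (V → ℕ), if i ∈ x.1.1 then μ x else 0 := by
    have h1 : (∑' x, μ x) * ENNReal.ofReal (lam i)
        ≤ ∑' x : ActState G × (V → ℕ), if x.2 i ≠ 0 ∧ i ∈ x.1.1 then μ x else 0 := by
      rw [← ENNReal.tsum_mul_right]
      calc ∑' x, μ x * ENNReal.ofReal (lam i)
          = ∑' n, ∑' x : ActState G × (V → ℕ),
              (if x.2 i = n then μ x * ENNReal.ofReal (lam i) else 0) := by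
            rw [ENNReal.tsum_comm]
            refine tsum_congr fun x => ?_
            exact (tsum_ite_eq' (x.2 i) (fun _ => μ x * ENNReal.ofReal (lam i))).symm
        _ ≤ ∑' n, ∑' x : ActState G × (V → ℕ),
              (if x.2 i = n + 1 ∧ i ∈ x.1.1 then μ x else 0) :=
            ENNReal.tsum_le_tsum fun n => queue_balance G lam nu μ hinv hfin i n
        _ = _ := by
            rw [ENNReal.tsum_comm]
            refine tsum_congr fun x => ?_
            by_cases hx : x.2 i ≠ 0 ∧ i ∈ x.1.1
            · rw [if_pos hx, tsum_eq_single (x.2 i - 1)]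
              · rw [if_pos ⟨by omega, hx.2⟩]
              · intro n hn
                rw [if_neg]
                rintro ⟨h, -⟩
                omega
            · rw [if_neg hx]
              refine ENNReal.tsum_eq_zero.2 fun n => if_neg ?_
              rintro ⟨h, h'⟩
              exact hx ⟨by omega, h'⟩
    refine lt_of_le_of_lt h1 ?_
    have hne : ∑' x : ActState G × (V → ℕ), (if x.2 i ≠ 0 ∧ i ∈ x.1.1 then μ x else 0) ≠ ∞ :=
      ne_top_of_le_ne_top hmass (ENNReal.tsum_le_tsum fun x => by split_ifs <;> simp)
    refine ENNReal.tsum_lt_tsum hne (i := z) (fun x => ?_) ?_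
    · split_ifs with h2 h3 h3
      · exact le_rfl
      · exact absurd h2.2 h3
      · exact zero_le
      · exact le_rfl
    · simpa [hz] using pos_iff_ne_zero.2 hμz
  -- the marginal distribution of the activity pattern
  set M : ActState G → ℝ≥0∞ := fun u => ∑' X, μ (u, X) with hM
  have hMsum : ∑ u, M u = ∑' x, μ x := by
    rw [ENNReal.tsum_prod', tsum_fintype]
  have hMtop : ∀ u, M u ≠ ∞ := fun u => by
    rw [← hMsum] at hmass
    exact (ENNReal.sum_ne_top.1 hmass) u (Finset.mem_univ u)
  set Λ : ℝ≥0∞ := ∑ j, ENNReal.ofReal (lam j) with hΛ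
  have hΛtop : Λ ≠ ∞ := by simp [hΛ, ENNReal.sum_eq_top]
  -- Sum the invariance equations over the queue lengths. Arrivals leave the activity pattern
  -- unchanged and contribute the same finite term to both sides.
  have hMinv : ∀ w, M w * Λ + ∑ u, M u * ENNReal.ofReal (activityRate G nu u w)
      = M w * Λ + M w * ∑ v, ENNReal.ofReal (activityRate G nu w v) := by
    intro w
    have h1 : ∑' X', ∑' x, μ x * q x (w, X') = ∑' X', μ (w, X') * RateChain.exitRate q (w, X') :=
      tsum_congr fun X' => hinv (w, X')
    rw [ENNReal.tsum_comm, ENNReal.tsum_prod', tsum_fintype] at h1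
    simp_rw [ENNReal.tsum_mul_left, hq, tsum_networkRate G lam nu hnu, hexit,
      ENNReal.tsum_mul_right, mul_add] at h1
    rw [Finset.sum_add_distrib] at h1
    rw [← h1]
    congr 1
    simp [hM, hΛ]
  have hstat : ∀ w, ∑ u, (M u).toReal * activityRate G nu u w
      = (M w).toReal * ∑ v, activityRate G nu w v := by
    intro w
    have h1 := (ENNReal.add_right_inj (ENNReal.mul_ne_top (hMtop w) hΛtop)).1 (hMinv w)
    have h2 := congrArg ENNReal.toReal h1
    rw [ENNReal.toReal_sum fun u _ => ENNReal.mul_ne_top (hMtop u) ENNReal.ofReal_ne_top,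
      ENNReal.toReal_mul, ENNReal.toReal_sum fun u _ => ENNReal.ofReal_ne_top] at h2
    simp_rw [ENNReal.toReal_mul, ENNReal.toReal_ofReal (activityRate_nonneg G nu hnu _ _)] at h2
    exact h2
  have hprop := eq_smul_equilibrium G nu hnu (fun u => (M u).toReal) hstat
  set C : ℝ := ∑ u, (M u).toReal with hC
  have hCeq : C = (∑' x, μ x).toReal := by
    rw [← hMsum, ENNReal.toReal_sum fun u _ => hMtop u]
  have hCpos : 0 < C := by
    rw [hCeq]
    exact ENNReal.toReal_pos (fun h => hμz (ENNReal.tsum_eq_zero.1 h z)) hmass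
  have hact : ∑' x : ActState G × (V → ℕ), (if i ∈ x.1.1 then μ x else 0)
      = ∑ u : ActState G, if i ∈ u.1 then M u else 0 := by
    rw [ENNReal.tsum_prod', tsum_fintype]
    refine Finset.sum_congr rfl fun u _ => ?_
    split_ifs <;> simp [hM]
  rw [hact] at hqueue
  have hterm : ∀ u : ActState G, (if i ∈ u.1 then M u else 0) ≠ ∞ := fun u => by
    split_ifs
    · exact hMtop u
    · exact ENNReal.zero_ne_top
  have h2 := (ENNReal.toReal_lt_toReal
    (ENNReal.mul_ne_top hmass ENNReal.ofReal_ne_top)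
    (ENNReal.sum_ne_top.2 fun u _ => hterm u)).2 hqueue
  rw [ENNReal.toReal_mul, ← hCeq, ENNReal.toReal_ofReal (hlam i).le,
    ENNReal.toReal_sum fun u _ => hterm u] at h2
  have h3 : ∑ u : ActState G, (if i ∈ u.1 then M u else 0).toReal
      = C * ∑ u : ActState G, if i ∈ u.1 then equilibrium G nu u else 0 := by
    rw [Finset.mul_sum]
    refine Finset.sum_congr rfl fun u _ => ?_
    split_ifs
    · exact hprop u
    · simp
  rw [h3] at h2
  exact lt_of_mul_lt_mul_left h2 hCpos.le

end RandomAccess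

/-! ### Stationary probabilities in a complete partite graph -/

namespace RandomAccess

variable {V : Type*} [Fintype V] [DecidableEq V]

/-- The stationary probability that node `i` is active. -/
def activeProb (G : SimpleGraph V) (nu : V → ℝ) (i : V) : ℝ :=
  ∑ u : ActState G, if i ∈ u.1 then equilibrium G nu u else 0

/-- The activity state in which only node `i` is active. -/
def singleState (G : SimpleGraph V) (i : V) : ActState G := ⟨{i}, by simp⟩

/-- The activity state in which no node is active. -/
def emptyState (G : SimpleGraph V) : ActState G := ⟨∅, by simp⟩

theorem sum_actState_ite (G : SimpleGraph V) (s : Finset (Finset V))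
    (hs : ∀ T ∈ s, G.IsIndepSet (T : Set V)) (f : Finset V → ℝ) :
    ∑ u : ActState G, (if u.1 ∈ s then f u.1 else 0) = ∑ T ∈ s, f T := by
  rw [← Finset.sum_filter]
  refine Finset.sum_bij (fun u _ => u.1) (fun u hu => (Finset.mem_filter.1 hu).2)
    (fun u _ v _ h => Subtype.ext h) (fun T hT => ⟨⟨T, hs T hT⟩, ?_, rfl⟩) (fun _ _ => rfl)
  exact Finset.mem_filter.2 ⟨Finset.mem_univ _, hT⟩

section Partite

variable {K : ℕ} {G : SimpleGraph V} {comp : V → Fin K}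

/-- The nodes of a component. -/
def component (comp : V → Fin K) (k : Fin K) : Finset V :=
  Finset.univ.filter fun i => comp i = k

theorem ActState.comp_eq (hG : ∀ i j, G.Adj i j ↔ comp i ≠ comp j) (u : ActState G) {i j : V}
    (hi : i ∈ u.1) (hj : j ∈ u.1) : comp i = comp j := by
  by_cases hij : i = j
  · rw [hij]
  · by_contra h
    exact u.2 hi hj hij ((hG i j).2 h)

theorem isIndepSet_of_comp (hG : ∀ i j, G.Adj i j ↔ comp i ≠ comp j) (T : Finset V) (k : Fin K)
    (hT : ∀ i ∈ T, comp i = k) : G.IsIndepSet (T : Set V) := fun i hi j hj _ hadj =>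
  (hG i j).1 hadj ((hT i hi).trans (hT j hj).symm)

/-- The stationary probability that no node is active outside the component of `i`,
and `i` is not active either. -/
def restProb (G : SimpleGraph V) (comp : V → Fin K) (nu : V → ℝ) (i : V) : ℝ :=
  ∑ u : ActState G,
    if u.1 ∈ ((component comp (comp i)).erase i).powerset then equilibrium G nu u else 0

theorem comp_of_mem_powerset {i j : V} {T : Finset V}
    (hT : T ∈ ((component comp (comp i)).erase i).powerset) (hj : j ∈ T) :
    j ≠ i ∧ comp j = comp i := by
  have := Finset.mem_powerset.1 hT hj
  simpa [component] using this

/-- Every subset of a component is independent, so the weights sum to a full product of factors `1 +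
ν_j`. -/
theorem restProb_eq (hG : ∀ i j, G.Adj i j ↔ comp i ≠ comp j) (nu : V → ℝ) (i : V) :
    restProb G comp nu i = (∏ j ∈ (component comp (comp i)).erase i, (1 + nu j))
      / ∑ v : ActState G, ∏ j ∈ v.1, nu j := by
  have h := sum_actState_ite G ((component comp (comp i)).erase i).powerset
    (fun T hT => isIndepSet_of_comp hG T (comp i) fun j hj => (comp_of_mem_powerset hT hj).2)
    (fun T => (∏ j ∈ T, nu j) / ∑ v : ActState G, ∏ j ∈ v.1, nu j)
  rw [← Finset.sum_div, ← Finset.prod_one_add] at h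
  exact h

/-- A state containing `i` lies in the component of `i`; erasing `i` is a bijection onto the subsets
counted by `restProb` and removes a factor `ν_i`. -/
theorem activeProb_eq (hG : ∀ i j, G.Adj i j ↔ comp i ≠ comp j) (nu : V → ℝ) (i : V) :
    activeProb G nu i = nu i * restProb G comp nu i := by
  set P := ((component comp (comp i)).erase i).powerset with hP
  have hmem : ∀ T ∈ P, i ∉ T := fun T hT hi => (comp_of_mem_powerset hT hi).1 rfl
  have h := sum_actState_ite G (P.image (insert i))
    (fun T hT => by
      obtain ⟨T', hT', rfl⟩ := Finset.mem_image.1 hT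
      refine isIndepSet_of_comp hG _ (comp i) fun j hj => ?_
      rcases Finset.mem_insert.1 hj with rfl | hj
      · rfl
      · exact (comp_of_mem_powerset hT' hj).2)
    (fun T => (∏ j ∈ T, nu j) / ∑ v : ActState G, ∏ j ∈ v.1, nu j)
  have hiff : ∀ u : ActState G, u.1 ∈ P.image (insert i) ↔ i ∈ u.1 := by
    intro u
    refine ⟨fun hu => ?_, fun hi => Finset.mem_image.2 ⟨u.1.erase i, ?_, Finset.insert_erase hi⟩⟩
    · obtain ⟨T, -, hT⟩ := Finset.mem_image.1 hu
      rw [← hT]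
      exact Finset.mem_insert_self _ _
    · refine Finset.mem_powerset.2 (Finset.erase_subset_erase i fun j hj => ?_)
      simpa [component] using ActState.comp_eq hG u hj hi
  rw [Finset.sum_image fun T hT T' hT' hTT => by
    rw [← Finset.erase_insert (hmem T hT), ← Finset.erase_insert (hmem T' hT'), hTT]] at h
  simp_rw [hiff] at h
  have h2 : ∑ T ∈ P, (∏ j ∈ insert i T, nu j) / ∑ v : ActState G, ∏ j ∈ v.1, nu j
      = nu i * restProb G comp nu i := by
    rw [restProb_eq hG, Finset.prod_one_add, ← hP, mul_div_assoc', Finset.mul_sum, Finset.sum_div]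
    exact Finset.sum_congr rfl fun T hT => by rw [Finset.prod_insert (hmem T hT)]
  rw [← h2, ← h]
  rfl

/-- The source of the exponent `M - 1`: each other node of the component makes the exit state `{i}`
rarer by a factor `1 + ν_j`. -/
theorem equilibrium_singleState_mul (hG : ∀ i j, G.Adj i j ↔ comp i ≠ comp j) (nu : V → ℝ)
    (i : V) : equilibrium G nu (singleState G i)
      * ∏ j ∈ (component comp (comp i)).erase i, (1 + nu j) = activeProb G nu i := by
  rw [activeProb_eq hG, restProb_eq hG, equilibrium, singleState, Finset.prod_singleton]
  ring

theorem sum_representatives_le_one (hG : ∀ i j, G.Adj i j ↔ comp i ≠ comp j) (rep : Fin K → V)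
    (hrep : ∀ l, comp (rep l) = l) (s : Finset (Fin K)) (u : ActState G) :
    ∑ l ∈ s, (if rep l ∈ u.1 then (1 : ℝ) else 0) ≤ 1 := by
  rw [Finset.sum_boole]
  have : (s.filter fun l => rep l ∈ u.1).card ≤ 1 := Finset.card_le_one.2 fun a ha b hb => by
    have := ActState.comp_eq hG u (Finset.mem_filter.1 ha).2 (Finset.mem_filter.1 hb).2
    rwa [hrep, hrep] at this
  exact_mod_cast this

theorem sum_activeProb (nu : V → ℝ) (rep : Fin K → V) (s : Finset (Fin K)) :
    ∑ l ∈ s, activeProb G nu (rep l)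
      = ∑ u, equilibrium G nu u * ∑ l ∈ s, (if rep l ∈ u.1 then (1 : ℝ) else 0) := by
  simp_rw [activeProb, Finset.mul_sum, mul_ite, mul_one, mul_zero]
  exact Finset.sum_comm

theorem sum_activeProb_add_restProb_le_one (hG : ∀ i j, G.Adj i j ↔ comp i ≠ comp j) (nu : V → ℝ)
    (hnu : ∀ i, 0 < nu i) (rep : Fin K → V) (hrep : ∀ l, comp (rep l) = l) (k : Fin K) :
    ∑ l, activeProb G nu (rep l) + restProb G comp nu (rep k) ≤ 1 := by
  rw [sum_activeProb, restProb, ← Finset.sum_add_distrib]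
  refine le_trans (Finset.sum_le_sum fun u _ => ?_) (sum_equilibrium G nu hnu).le
  split_ifs with hu
  · rw [Finset.sum_eq_zero, mul_zero, zero_add]
    intro l _
    refine if_neg fun hl => ?_
    obtain ⟨h1, h2⟩ := comp_of_mem_powerset hu hl
    rw [hrep, hrep] at h2
    exact h1 (by rw [h2])
  · rw [add_zero]
    exact mul_le_of_le_one_right (equilibrium_pos G nu hnu u).le
      (sum_representatives_le_one hG rep hrep _ u)

open scoped Classical in
/-- The states in which a given component is active. -/
def activeStates (G : SimpleGraph V) (comp : V → Fin K) (k : Fin K) : Finset (ActState G) :=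
  Finset.univ.filter fun u => ∃ i ∈ u.1, comp i = k

theorem mem_activeStates {k : Fin K} {u : ActState G} :
    u ∈ activeStates G comp k ↔ ∃ i ∈ u.1, comp i = k := by
  simp [activeStates]

theorem sum_activeProb_add_empty_le (hG : ∀ i j, G.Adj i j ↔ comp i ≠ comp j) (nu : V → ℝ)
    (hnu : ∀ i, 0 < nu i) (rep : Fin K → V) (hrep : ∀ l, comp (rep l) = l) (k : Fin K) :
    ∑ l ∈ Finset.univ.erase k, activeProb G nu (rep l) + equilibrium G nu (emptyState G)
      ≤ ∑ u ∈ (activeStates G comp k)ᶜ, equilibrium G nu u := by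
  have h1 : equilibrium G nu (emptyState G)
      = ∑ u, if u = emptyState G then equilibrium G nu u else 0 := by simp
  rw [sum_activeProb, h1, ← Finset.sum_add_distrib, ← Finset.univ_inter (activeStates G comp k)ᶜ,
    ← Finset.sum_ite_mem]
  refine Finset.sum_le_sum fun u _ => ?_
  by_cases hu : u ∈ activeStates G comp k
  · rw [if_neg (fun h => Finset.mem_compl.1 h hu), if_neg, Finset.sum_eq_zero, mul_zero, zero_add]
    · intro l hl
      refine if_neg fun hlu => Finset.ne_of_mem_erase hl ?_
      obtain ⟨i, hi, hik⟩ := mem_activeStates.1 hu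
      rw [← hrep l, ← hik]
      exact ActState.comp_eq hG u hlu hi
    · rintro rfl
      obtain ⟨i, hi, -⟩ := mem_activeStates.1 hu
      simp [emptyState] at hi
  · rw [if_pos (Finset.mem_compl.2 hu)]
    split_ifs with h
    · subst h
      simp [emptyState]
    · rw [add_zero]
      exact mul_le_of_le_one_right (equilibrium_pos G nu hnu u).le
        (sum_representatives_le_one hG rep hrep _ u)

theorem activeProb_le_sum_activeStates (nu : V → ℝ) (hnu : ∀ i, 0 < nu i) (i : V) :
    activeProb G nu i ≤ ∑ u ∈ activeStates G comp (comp i), equilibrium G nu u := by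
  rw [activeProb, ← Finset.univ_inter (activeStates G comp (comp i)), ← Finset.sum_ite_mem]
  refine Finset.sum_le_sum fun u _ => ?_
  split_ifs with h1 h2 h2
  · exact le_rfl
  · exact absurd (mem_activeStates.2 ⟨i, h1, rfl⟩) h2
  · exact (equilibrium_pos G nu hnu u).le
  · exact le_rfl

/-- A component only becomes inactive through a state with a single active node. -/
theorem flow_activeStates_le (hG : ∀ i j, G.Adj i j ↔ comp i ≠ comp j) (nu : V → ℝ)
    (hnu : ∀ i, 0 < nu i) (k : Fin K) :
    ∑ u ∈ activeStates G comp k, ∑ v ∈ (activeStates G comp k)ᶜ,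
        equilibrium G nu u * activityRate G nu u v
      ≤ ∑ i ∈ component comp k, equilibrium G nu (singleState G i) := by
  have hrate : ∀ u ∈ activeStates G comp k, ∀ v ∈ (activeStates G comp k)ᶜ,
      activityRate G nu u v ≤ ∑ i ∈ component comp k,
        if u = singleState G i then (if v = emptyState G then 1 else 0) else 0 := by
    intro u hu v hv
    rw [Finset.mem_compl] at hv
    rw [activityRate, ← Finset.univ_inter (component comp k), ← Finset.sum_ite_mem]
    obtain ⟨j, hj, hjk⟩ := mem_activeStates.1 hu
    refine Finset.sum_le_sum fun i _ => ?_
    rw [if_neg, zero_add]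
    · by_cases h : i ∈ u.1 ∧ v.1 = u.1.erase i
      · have hik : comp i = k := (ActState.comp_eq hG u h.1 hj).trans hjk
        have hvempty : v.1 = ∅ := by
          refine Finset.eq_empty_of_forall_notMem fun l hl => hv (mem_activeStates.2 ⟨l, hl, ?_⟩)
          rw [h.2] at hl
          exact (ActState.comp_eq hG u (Finset.mem_of_mem_erase hl) hj).trans hjk
        have hv0 : v = emptyState G := Subtype.ext hvempty
        have husingle : u = singleState G i := by
          refine Subtype.ext ?_
          rw [← Finset.insert_erase h.1, ← h.2, hvempty]
          rfl
        rw [if_pos h, if_pos (by simpa [component] using hik), if_pos husingle,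
          if_pos hv0]
      · rw [if_neg h]
        split_ifs <;> norm_num
    · rintro ⟨-, h⟩
      exact hv (mem_activeStates.2 ⟨j, by rw [h]; exact Finset.mem_insert_of_mem hj, hjk⟩)
  have hnn : ∀ u, 0 ≤ equilibrium G nu u := fun u => (equilibrium_pos G nu hnu u).le
  calc _ ≤ ∑ u ∈ activeStates G comp k, ∑ v ∈ (activeStates G comp k)ᶜ, ∑ i ∈ component comp k,
        equilibrium G nu u
          * (if u = singleState G i then (if v = emptyState G then 1 else 0) else 0) := by
        refine Finset.sum_le_sum fun u hu => Finset.sum_le_sum fun v hv => ?_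
        rw [← Finset.mul_sum]
        exact mul_le_mul_of_nonneg_left (hrate u hu v hv) (hnn u)
    _ ≤ ∑ u, ∑ v, ∑ i ∈ component comp k, equilibrium G nu u
          * (if u = singleState G i then (if v = emptyState G then 1 else 0) else 0) := by
        have h0 : ∀ u v, 0 ≤ ∑ i ∈ component comp k, equilibrium G nu u
          * (if u = singleState G i then (if v = emptyState G then 1 else 0) else 0) := by
          intro u v
          refine Finset.sum_nonneg fun i _ => mul_nonneg (hnn u) ?_
          split_ifs <;> norm_num
        refine (Finset.sum_le_sum fun u _ => Finset.sum_le_sum_of_subset_of_nonneg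
          (Finset.subset_univ _) fun v _ _ => h0 u v).trans ?_
        exact Finset.sum_le_sum_of_subset_of_nonneg (Finset.subset_univ _)
          fun u _ _ => Finset.sum_nonneg fun v _ => h0 u v
    _ = _ := by
        have h1 : ∀ u, ∑ v, ∑ i ∈ component comp k, equilibrium G nu u
            * (if u = singleState G i then (if v = emptyState G then 1 else 0) else 0)
            = ∑ i ∈ component comp k, if u = singleState G i then equilibrium G nu u else 0 := by
          intro u
          rw [Finset.sum_comm]
          refine Finset.sum_congr rfl fun i _ => ?_
          split_ifs <;> simp
        simp_rw [h1]
        rw [Finset.sum_comm]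
        simp

/-! ### Bounds on the activation rates and the mixing time -/

theorem minLoad_le (r : Fin K → ℝ) (k : Fin K) : minLoad r ≤ r k :=
  ciInf_le (Set.finite_range r).bddBelow k

theorem totalLoad_lt_one (hG : ∀ i j, G.Adj i j ↔ comp i ≠ comp j)
    (r : Fin K → ℝ) (nu : V → ℝ) (hnu : ∀ i, 0 < nu i)
    (hload : ∀ i, r (comp i) < activeProb G nu i) (rep : Fin K → V)
    (hrep : ∀ l, comp (rep l) = l) (k : Fin K) :
    totalLoad r + restProb G comp nu (rep k) < 1 := by
  refine lt_of_lt_of_le ?_ (sum_activeProb_add_restProb_le_one hG nu hnu rep hrep k)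
  refine add_lt_add_left (Finset.sum_lt_sum_of_nonempty ⟨k, Finset.mem_univ k⟩ fun l _ => ?_) _
  simpa [hrep] using hload (rep l)

theorem restProb_pos (hG : ∀ i j, G.Adj i j ↔ comp i ≠ comp j) (nu : V → ℝ)
    (hnu : ∀ i, 0 < nu i) (i : V) : 0 < restProb G comp nu i := by
  rw [restProb_eq hG]
  exact div_pos (Finset.prod_pos fun j _ => by linarith [hnu j])
    (Finset.sum_pos (fun _ _ => Finset.prod_pos fun j _ => hnu j) Finset.univ_nonempty)

/-- If the active probabilities exceed the loads, the activation rates are large. -/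
theorem div_le_activation_rate (hG : ∀ i j, G.Adj i j ↔ comp i ≠ comp j)
    (hcomp : Function.Surjective comp)
    (r : Fin K → ℝ) (nu : V → ℝ) (hnu : ∀ i, 0 < nu i)
    (hload : ∀ i, r (comp i) < activeProb G nu i) (i : V) :
    totalLoad r < 1 ∧ minLoad r / (1 - totalLoad r) ≤ nu i := by
  -- Representatives are arbitrary except that `i` must represent its own component, so that
  -- `restProb` at `i` is the one being bounded.
  set rep : Fin K → V := Function.update (Function.surjInv hcomp) (comp i) i with hrepdef
  have hrep : ∀ l, comp (rep l) = l := by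
    intro l
    by_cases hl : l = comp i
    · subst hl; simp [hrepdef]
    · simp [hrepdef, hl, Function.surjInv_eq]
  have hri : rep (comp i) = i := by simp [hrepdef]
  have h1 := totalLoad_lt_one hG r nu hnu hload rep hrep (comp i)
  rw [hri] at h1
  have hA := restProb_pos hG nu hnu i
  have hlt : totalLoad r < 1 := by linarith
  refine ⟨hlt, ?_⟩
  rw [div_le_iff₀ (by linarith)]
  have h2 := hload i
  rw [activeProb_eq hG] at h2
  have h3 : nu i * restProb G comp nu i ≤ nu i * (1 - totalLoad r) :=
    mul_le_mul_of_nonneg_left (by linarith) (hnu i).le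
  linarith [minLoad_le r (comp i)]

/-- Lower bound for the mixing time in terms of the probability that a component is inactive. -/
theorem inactiveProb_sub_le (hG : ∀ i j, G.Adj i j ↔ comp i ≠ comp j)
    (nu : V → ℝ) (hnu : ∀ i, 0 < nu i) (b : ℝ) (hb : 0 ≤ b) (hbnu : ∀ i, b ≤ nu i)
    (k : Fin K) (hk : (component comp k).Nonempty) (t ε : ℝ) (ht : 0 ≤ t)
    (hε : mixDist G nu t ≤ ε) :
    (∑ u ∈ (activeStates G comp k)ᶜ, equilibrium G nu u - ε) * b ^ ((component comp k).card - 1)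
      ≤ t * (component comp k).card := by
  set S := activeStates G comp k with hS
  set p := ∑ u ∈ S, equilibrium G nu u with hp
  have hsingle : ∀ i ∈ component comp k,
      equilibrium G nu (singleState G i) * b ^ ((component comp k).card - 1) ≤ p := by
    intro i hi
    have hik : comp i = k := by simpa [component] using hi
    have h1 := activeProb_le_sum_activeStates (G := G) (comp := comp) nu hnu i
    rw [← equilibrium_singleState_mul hG, hik] at h1
    refine le_trans (mul_le_mul_of_nonneg_left ?_ (equilibrium_pos G nu hnu _).le) h1
    rw [← Finset.card_erase_of_mem hi, ← Finset.prod_const]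
    exact Finset.prod_le_prod (fun _ _ => hb) fun j _ => by linarith [hbnu j]
  have hflow : (∑ u ∈ S, ∑ v ∈ Sᶜ, equilibrium G nu u * activityRate G nu u v)
      * b ^ ((component comp k).card - 1) ≤ (component comp k).card * p := by
    refine (mul_le_mul_of_nonneg_right (flow_activeStates_le hG nu hnu k)
      (pow_nonneg hb _)).trans ?_
    rw [Finset.sum_mul, ← nsmul_eq_mul]
    exact Finset.sum_le_card_nsmul _ _ _ hsingle
  obtain ⟨i, hi⟩ := hk
  have hp0 : 0 < p := by
    refine Finset.sum_pos (fun u _ => equilibrium_pos G nu hnu u) ⟨singleState G i, ?_⟩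
    exact mem_activeStates.2 ⟨i, by simp [singleState], by simpa [component] using hi⟩
  have hbot := bottleneck G nu hnu t ε ht hε S
  refine le_of_mul_le_mul_left ?_ hp0
  calc p * ((∑ u ∈ Sᶜ, equilibrium G nu u - ε) * b ^ ((component comp k).card - 1))
      = (p * (∑ u ∈ Sᶜ, equilibrium G nu u - ε)) * b ^ ((component comp k).card - 1) := by ring
    _ ≤ (t * ∑ u ∈ S, ∑ v ∈ Sᶜ, equilibrium G nu u * activityRate G nu u v)
        * b ^ ((component comp k).card - 1) := mul_le_mul_of_nonneg_right hbot (pow_nonneg hb _)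
    _ = t * ((∑ u ∈ S, ∑ v ∈ Sᶜ, equilibrium G nu u * activityRate G nu u v)
        * b ^ ((component comp k).card - 1)) := by ring
    _ ≤ t * ((component comp k).card * p) := mul_le_mul_of_nonneg_left hflow ht
    _ = p * (t * (component comp k).card) := by ring

theorem exists_card_component_eq_maxSize (hK : 0 < K) (hcomp : Function.Surjective comp) :
    ∃ k, (component comp k).card = maxSize comp ∧ (component comp k).Nonempty := by
  obtain ⟨k, -, hk⟩ := Finset.exists_mem_eq_sup (Finset.univ : Finset (Fin K))
    ⟨⟨0, hK⟩, Finset.mem_univ _⟩ (fun k => (component comp k).card)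
  obtain ⟨i, hi⟩ := hcomp k
  exact ⟨k, hk.symm, i, by simpa [component] using hi⟩

/-- The active times of representatives of the other `K - 1` components are disjoint and exclude
component `k`. The empty state adds positive mass, so the inequality is strict even for `K = 1`. -/
theorem lt_inactiveProb (hG : ∀ i j, G.Adj i j ↔ comp i ≠ comp j)
    (hcomp : Function.Surjective comp) (r : Fin K → ℝ) (nu : V → ℝ) (hnu : ∀ i, 0 < nu i)
    (hload : ∀ i, r (comp i) < activeProb G nu i) (k : Fin K) :
    ((K : ℝ) - 1) * minLoad r < ∑ u ∈ (activeStates G comp k)ᶜ, equilibrium G nu u := by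
  refine lt_of_lt_of_le ?_ (sum_activeProb_add_empty_le hG nu hnu (Function.surjInv hcomp)
    (Function.surjInv_eq hcomp) k)
  have h1 : (Finset.univ.erase k).card • minLoad r
      ≤ ∑ l ∈ Finset.univ.erase k, activeProb G nu (Function.surjInv hcomp l) := by
    refine Finset.card_nsmul_le_sum _ _ _ fun l _ => (minLoad_le r l).trans ?_
    simpa [Function.surjInv_eq] using (hload (Function.surjInv hcomp l)).le
  have hK : 1 ≤ K := Nat.one_le_of_lt k.2
  rw [Finset.card_erase_of_mem (Finset.mem_univ k), Finset.card_univ, Fintype.card_fin,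
    nsmul_eq_mul, Nat.cast_sub hK, Nat.cast_one] at h1
  linarith [equilibrium_pos G nu hnu (emptyState G)]

theorem maxSize_pos (hK : 0 < K) (hcomp : Function.Surjective comp) : 0 < maxSize comp := by
  obtain ⟨k, hk, hne⟩ := exists_card_component_eq_maxSize hK hcomp
  rw [← hk]
  exact Finset.card_pos.2 hne

theorem minLoad_pos (hK : 0 < K) (r : Fin K → ℝ) (hr : ∀ k, 0 < r k) : 0 < minLoad r := by
  have : Nonempty (Fin K) := ⟨⟨0, hK⟩⟩
  obtain ⟨k, hk⟩ := exists_eq_ciInf_of_finite (f := r)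
  rw [minLoad, ← hk]
  exact hr k

theorem minLoad_le_totalLoad (hK : 0 < K) (r : Fin K → ℝ) (hr : ∀ k, 0 < r k) :
    minLoad r ≤ totalLoad r :=
  (minLoad_le r ⟨0, hK⟩).trans
    (Finset.single_le_sum (fun k _ => (hr k).le) (Finset.mem_univ _))

theorem lt_mixingTime (hK : 0 < K) (hG : ∀ i j, G.Adj i j ↔ comp i ≠ comp j)
    (hcomp : Function.Surjective comp) (r : Fin K → ℝ) (hr : ∀ k, 0 < r k)
    (nu : V → ℝ) (hnu : ∀ i, 0 < nu i)
    (hload : ∀ i, r (comp i) < activeProb G nu i) (hlt : totalLoad r < 1) (ε : ℝ) :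
    (((((K : ℝ) - 1) * minLoad r - 2 * ε) * (minLoad r ^ maxSize comp / (maxSize comp : ℝ))
      * (1 / (1 - totalLoad r)) ^ (maxSize comp - 1) : ℝ) : EReal) < mixingTime G nu ε := by
  have hM := maxSize_pos hK hcomp
  have hmin := minLoad_pos hK r hr
  obtain ⟨k, hk, hne⟩ := exists_card_component_eq_maxSize hK hcomp
  have hx : 0 < 1 - totalLoad r := by linarith
  set b := minLoad r / (1 - totalLoad r) with hb
  have hb0 : 0 < b := div_pos hmin hx
  set M := maxSize comp with hMdef
  set D := ∑ u ∈ (activeStates G comp k)ᶜ, equilibrium G nu u with hD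
  have hDlt : ((K : ℝ) - 1) * minLoad r < D := lt_inactiveProb hG hcomp r nu hnu hload k
  have hMR : (0 : ℝ) < M := by exact_mod_cast hM
  have hkey : ∀ t : ℝ, 0 ≤ t → mixDist G nu t ≤ ε → (D - ε) * b ^ (M - 1) / M ≤ t := by
    intro t ht htε
    have h := inactiveProb_sub_le hG nu hnu b hb0.le
      (fun i => (div_le_activation_rate hG hcomp r nu hnu hload i).2) k hne t ε ht htε
    rw [hk] at h
    rwa [div_le_iff₀ hMR]
  have hlhs : (((K : ℝ) - 1) * minLoad r - 2 * ε) * (minLoad r ^ M / (M : ℝ))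
      * (1 / (1 - totalLoad r)) ^ (M - 1)
      = (((K : ℝ) - 1) * minLoad r - 2 * ε) * (minLoad r * b ^ (M - 1) / M) := by
    have hpow : minLoad r ^ M = minLoad r * minLoad r ^ (M - 1) := by
      rw [← pow_succ', Nat.sub_add_cancel hM]
    rw [hpow, hb, div_pow, div_pow, one_pow]
    ring
  rw [hlhs]
  have hq : 0 < b ^ (M - 1) / M := div_pos (pow_pos hb0 _) hMR
  -- For `ε < 0` the distance is never reached and the mixing time is `⊤`.
  rcases lt_or_ge ε 0 with hε | hε
  · have hempty : {t : ℝ | 0 ≤ t ∧ mixDist G nu t ≤ ε} = ∅ :=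
      Set.eq_empty_of_forall_notMem fun t ht =>
        absurd (ht.2.trans_lt hε) (not_lt.2 (mixDist_nonneg G nu t))
    rw [mixingTime, hempty, Set.image_empty, sInf_empty]
    exact EReal.coe_lt_top _
  have hinf : ((max 0 ((D - ε) * b ^ (M - 1) / M) : ℝ) : EReal) ≤ mixingTime G nu ε := by
    refine le_sInf ?_
    rintro _ ⟨t, ht, rfl⟩
    exact EReal.coe_le_coe_iff.2 (max_le ht.1 (hkey t ht.1 ht.2))
  refine lt_of_lt_of_le (EReal.coe_lt_coe_iff.2 ?_) hinf
  -- A negative bound lies below `0`. Otherwise, `ρ_min ≤ ρ < 1` drops one factor `ρ_min`, and `D -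
  -- ε` exceeds `(K - 1) * ρ_min - 2 * ε` since `ε ≥ 0`.
  rcases lt_or_ge (((K : ℝ) - 1) * minLoad r - 2 * ε) 0 with hneg | hpos
  · refine lt_max_of_lt_left (mul_neg_of_neg_of_pos hneg ?_)
    rw [mul_div_assoc]
    exact mul_pos hmin hq
  · refine lt_max_of_lt_right ?_
    have h1 : minLoad r * (b ^ (M - 1) / M) ≤ b ^ (M - 1) / M :=
      mul_le_of_le_one_left hq.le (by linarith [minLoad_le_totalLoad hK r hr])
    rw [mul_div_assoc, mul_div_assoc]
    refine lt_of_le_of_lt (mul_le_mul_of_nonneg_left h1 hpos) (mul_lt_mul_of_pos_right ?_ hq)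
    linarith

end Partite

end RandomAccess

namespace RandomAccess

variable {V : Type*} [Fintype V] [DecidableEq V]

theorem totalLoad_lt_one_and_lt_mixingTime {K : ℕ} (hK : 0 < K) {G : SimpleGraph V}
    {comp : V → Fin K} (hcomp : Function.Surjective comp)
    (hG : ∀ i j, G.Adj i j ↔ comp i ≠ comp j) (r : Fin K → ℝ) (nu : V → ℝ) (hr : ∀ k, 0 < r k)
    (hnu : ∀ i, 0 < nu i) (hst : Stable G (fun i => r (comp i)) nu) :
    totalLoad r < 1 ∧ ∀ ε : ℝ,
      (((((K : ℝ) - 1) * minLoad r - 2 * ε) * (minLoad r ^ maxSize comp / (maxSize comp : ℝ))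
        * (1 / (1 - totalLoad r)) ^ (maxSize comp - 1) : ℝ) : EReal) < mixingTime G nu ε := by
  have hload : ∀ i, r (comp i) < activeProb G nu i :=
    load_lt_activeProb G (fun i => r (comp i)) nu (fun i => hr (comp i)) hnu hst
  obtain ⟨i, -⟩ := hcomp ⟨0, hK⟩
  have hlt := (div_le_activation_rate hG hcomp r nu hnu hload i).1
  exact ⟨hlt, lt_mixingTime hK hG hcomp r hr nu hnu hload hlt⟩

theorem le_minLoad {K : ℕ} (hK : 0 < K) (r : Fin K → ℝ) (δ : ℝ) (hr : ∀ k, δ ≤ r k) :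
    δ ≤ minLoad r :=
  have : Nonempty (Fin K) := ⟨⟨0, hK⟩⟩
  le_ciInf hr

end RandomAccess

end

theorem theorem3 {V : Type*} [Fintype V] [DecidableEq V] (K : ℕ) (hK : 0 < K)
    (G : SimpleGraph V) (comp : V → Fin K) (hcomp : Function.Surjective comp)
    (hG : ∀ i j, G.Adj i j ↔ comp i ≠ comp j) :
    (∀ (r : Fin K → ℝ) (nu : V → ℝ), (∀ k, 0 < r k) → (∀ i, 0 < nu i) →
      RandomAccess.Stable G (fun i => r (comp i)) nu →
      RandomAccess.totalLoad r < 1 ∧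
      ∀ ε : ℝ,
        (((((K : ℝ) - 1) * RandomAccess.minLoad r - 2 * ε)
            * (RandomAccess.minLoad r ^ RandomAccess.maxSize comp
                / (RandomAccess.maxSize comp : ℝ))
            * (1 / (1 - RandomAccess.totalLoad r)) ^ (RandomAccess.maxSize comp - 1) : ℝ) : EReal)
          < RandomAccess.mixingTime G nu ε) ∧
    (∀ δ ε : ℝ, 0 < δ → 2 * ε < ((K : ℝ) - 1) * δ →
      ∃ c : ℝ, 0 < c ∧
        ∀ (r : Fin K → ℝ) (nu : V → ℝ), (∀ k, δ ≤ r k) → (∀ i, 0 < nu i) →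
          RandomAccess.Stable G (fun i => r (comp i)) nu →
          ((c * (1 / (1 - RandomAccess.totalLoad r)) ^ (RandomAccess.maxSize comp - 1) : ℝ) : EReal)
            < RandomAccess.mixingTime G nu ε) := by
  have hmain := RandomAccess.totalLoad_lt_one_and_lt_mixingTime hK hcomp hG
  refine ⟨hmain, fun δ ε hδ hε => ?_⟩
  have hM : (0 : ℝ) < RandomAccess.maxSize comp := by
    exact_mod_cast RandomAccess.maxSize_pos hK hcomp
  -- The prefactor of the explicit bound with `δ` in place of `ρ_min`, in which it is monotone
  -- because the bracket is positive.
  refine ⟨(((K : ℝ) - 1) * δ - 2 * ε) * (δ ^ RandomAccess.maxSize comp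
    / (RandomAccess.maxSize comp : ℝ)), ?_, fun r nu hr hnu hst => ?_⟩
  · exact mul_pos (sub_pos.2 hε) (div_pos (pow_pos hδ _) hM)
  · obtain ⟨hlt, hmix⟩ := hmain r nu (fun k => hδ.trans_le (hr k)) hnu hst
    refine lt_of_le_of_lt (EReal.coe_le_coe_iff.2 ?_) (hmix ε)
    have hmin := RandomAccess.le_minLoad hK r δ hr
    have hK1 : (0 : ℝ) ≤ (K : ℝ) - 1 := sub_nonneg.2 (by exact_mod_cast hK)
    have h1 : ((K : ℝ) - 1) * δ - 2 * ε ≤ ((K : ℝ) - 1) * RandomAccess.minLoad r - 2 * ε :=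
      sub_le_sub_right (mul_le_mul_of_nonneg_left hmin hK1) _
    have h2 : δ ^ RandomAccess.maxSize comp / (RandomAccess.maxSize comp : ℝ)
        ≤ RandomAccess.minLoad r ^ RandomAccess.maxSize comp
          / (RandomAccess.maxSize comp : ℝ) :=
      div_le_div_of_nonneg_right (pow_le_pow_left₀ hδ.le hmin _) hM.le
    refine mul_le_mul_of_nonneg_right ?_
      (pow_nonneg (one_div_nonneg.2 (sub_nonneg.2 hlt.le)) _)
    exact mul_le_mul h1 h2 (div_nonneg (pow_nonneg hδ.le _) hM.le)
      ((sub_pos.2 hε).le.trans h1)
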